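/- Let $n\ge 1$ and $1<q<p<\infty$. For a measurable real- or complex-valued function $f$ on $\mathbb R^n$ let $d_f(\alpha)=|\{x:|f(x)|>\alpha\}|$ be its distribution function and $f^*(t)=\inf\{\alpha\ge 0: d_f(\alpha)\le t\}$ (with $\inf\varnothing=\infty$) its decreasing rearrangement, and set $$\|f\|_{L^{p,1}}=\int_0^\infty t^{1/p}f^*(t)\,\frac{dt}{t},\qquad \|f\|_{L^{q,\infty}}=\sup_{t>0}t^{1/q}f^*(t);$$ the Lorentz spaces $L^{p,1}(\mathbb R^n)$ and $L^{q,\infty}(\mathbb R^n)$ consist of the measurable functions for which the respective quantity is finite. Let $\mathrm{BMO}(\mathbb R^n)$ be the space of locally integrable functions $f$ for which $$\|f\|_{\mathrm{BMO}}=\sup_{Q}\frac1{|Q|}\int_Q|f-f_Q|\,dx,\qquad f_Q=\frac1{|Q|}\int_Q f\,dx,$$ is finite, the supremum being over all cubes $Q\subset\mathbb R^n$ with sides parallel to the axes. Then there is a constant $C$, depending only on $n$, $p$ and $q$, such that every $u\in L^{q,\infty}(\mathbb R^n)\cap\mathrm{BMO}(\mathbb R^n)$ belongs to $L^{p,1}(\mathbb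 R^n)$ and satisfies $$\|u\|_{L^{p,1}}\le C\,\|u\|_{L^{q,\infty}}^{q/p}\,\|u\|_{\mathrm{BMO}}^{1-q/p}.$$ -/

import Mathlib

open MeasureTheory
open scoped ENNReal NNReal

noncomputable section

/-- The distribution function `d_f(α) = |{x : |f x| > α}|` for Lebesgue measure on `ℝⁿ`. The space
`ℝⁿ` is modelled as `Fin n → ℝ`: only its topology and its Lebesgue measure are used below, and
these do not depend on the choice of a norm. -/
def distribFun {n : ℕ} {𝕜 : Type*} [RCLike 𝕜] (f : (Fin n → ℝ) → 𝕜) (α : ℝ≥0) : ℝ≥0∞ :=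
  volume {x | α < ‖f x‖₊}

/-- The decreasing rearrangement `f^*(t) = inf {α ≥ 0 : d_f(α) ≤ t}`, for `t ≥ 0`, with values in
`[0, ∞]`; the infimum of the empty set is `∞`. -/
def decrRearr {n : ℕ} {𝕜 : Type*} [RCLike 𝕜] (f : (Fin n → ℝ) → 𝕜) (t : ℝ) : ℝ≥0∞ :=
  ⨅ (α : ℝ≥0) (_ : distribFun f α ≤ ENNReal.ofReal t), (α : ℝ≥0∞)

/-- The Lorentz quantity `‖f‖_{L^{p,r}}`, with values in `[0, ∞]`, for `0 < p < ∞`, `0 < r ≤ ∞`: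
`(∫_0^∞ (t^{1/p} f^*(t))^r dt/t)^{1/r}` for `r < ∞`, and `sup_{t > 0} t^{1/p} f^*(t)` for
`r = ∞`. -/
def lorentzNorm {n : ℕ} {𝕜 : Type*} [RCLike 𝕜] (p : ℝ) (r : ℝ≥0∞) (f : (Fin n → ℝ) → 𝕜) :
    ℝ≥0∞ :=
  if r = ∞ then ⨆ (t : ℝ) (_ : 0 < t), ENNReal.ofReal t ^ (1 / p) * decrRearr f t
  else (∫⁻ t in Set.Ioi (0 : ℝ),
    (ENNReal.ofReal t ^ (1 / p) * decrRearr f t) ^ r.toReal / ENNReal.ofReal t) ^ (1 / r.toReal)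

/-- Membership in the Lorentz space `L^{p,r}(ℝⁿ)`. -/
def MemLorentz {n : ℕ} {𝕜 : Type*} [RCLike 𝕜] (p : ℝ) (r : ℝ≥0∞) (f : (Fin n → ℝ) → 𝕜) :
    Prop :=
  AEStronglyMeasurable f volume ∧ lorentzNorm p r f < ∞

/-- The closed cube with sides of length `s` parallel to the axes and lowest corner `a`. -/
def cube {n : ℕ} (a : Fin n → ℝ) (s : ℝ) : Set (Fin n → ℝ) :=
  {x | ∀ i, a i ≤ x i ∧ x i ≤ a i + s}

/-- The BMO seminorm `sup_Q |Q|⁻¹ ∫_Q |f - f_Q|`, with values in `[0, ∞]`, the supremum being over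
all cubes `Q` and `f_Q` being the average of `f` over `Q`. -/
def bmoNorm {n : ℕ} {𝕜 : Type*} [RCLike 𝕜] (f : (Fin n → ℝ) → 𝕜) : ℝ≥0∞ :=
  ⨆ (a : Fin n → ℝ) (s : ℝ) (_ : 0 < s), 
    ⨍⁻ x in cube a s, ‖f x - ⨍ y in cube a s, f y ∂volume‖ₑ ∂volume

/-- Membership in `BMO(ℝⁿ)`: locally integrable functions, so that the averages exist, with finite
BMO seminorm. -/
def MemBMO {n : ℕ} {𝕜 : Type*} [RCLike 𝕜] (f : (Fin n → ℝ) → 𝕜) : Prop :=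
  LocallyIntegrable f volume ∧ bmoNorm f < ∞

end

/-!
The rearrangement of `u` is estimated separately on two sides of the point `T` at which the weak
bound `u^*(t) ≤ A t^{-1/q}` equals `B`, where `A` and `B` are the weak Lorentz norm and the BMO
seminorm, that is `T = (A / B) ^ q`. For `t > T` the weak bound is integrable against
`t^{1/p - 1}` because `q < p`. For `t ≤ T` the BMO condition gives
`u^*(t) ≤ C B (1 + log (T / t))`, here weakened to a small power of `T / t`
(`decrRearr_le_rpow`). Both integrals are multiples of `A^{q/p} B^{1 - q/p}`.

The logarithmic bound comes from a substitute for the John–Nirenberg inequality, in which the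
distribution function itself plays the part of the initial scale
(`two_mul_distribFun_add_le`): raising the level by a fixed multiple of `B` halves the distribution
function. To see this, the set `E = {|u| > α}`, of finite measure, is covered by cubes of total
measure `≲ |E|` each of which lies at least half outside `E`
(`exists_covering_half_density`). On such a cube the mean of `u` is at most `α + 3 B` in absolute
value, so that Chebyshev's inequality for `|u - u_Q|` bounds the measure of the part of the cube
where `|u|` exceeds `α + (3 + M) B` by a fraction `1 / M` of the cube.

Cubes are treated as closed balls of the sup norm, which `Fin n → ℝ` carries.
-/

open Metric Filter Topology

/-! ### A covering by cubes in which a set has density about one half -/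

/-- At a density point of a set `E` of finite measure, `E` fills at least half of some ball but at
most half of the ball enlarged five times: multiply a small radius by `5` as long as `E` fills more
than half of the next ball. The radius is bounded in terms of `|E|` because balls of large radius have measure more than `2 |E|`. -/
theorem exists_radius_half_density {n : ℕ} (hn : 1 ≤ n) {E : Set (Fin n → ℝ)}
    (hE : volume E ≠ ∞) {x : Fin n → ℝ}
    (hx : Tendsto (fun r => volume (E ∩ closedBall x r) / volume (closedBall x r)) (𝓝[>] 0)
      (𝓝 1)) :
    ∃ r : ℝ, 0 < r ∧ r ≤ (volume E).toReal + 1 ∧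
      volume (closedBall x r) ≤ 2 * volume (E ∩ closedBall x r) ∧
      2 * volume (E ∩ closedBall x (5 * r)) ≤ volume (closedBall x (5 * r)) := by
  have large : ∀ r : ℝ, (volume E).toReal + 1 < r →
      2 * volume (E ∩ closedBall x r) < volume (closedBall x r) := by
    intro r hr
    have h0 : 0 ≤ (volume E).toReal := ENNReal.toReal_nonneg
    rw [Real.volume_pi_closedBall _ (by linarith), Fintype.card_fin]
    calc 2 * volume (E ∩ closedBall x r) ≤ 2 * volume E := by gcongr; exact Set.inter_subset_left
      _ = ENNReal.ofReal (2 * (volume E).toReal) := by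
        rw [ENNReal.ofReal_mul (by norm_num), ENNReal.ofReal_toReal hE]; simp
      _ < ENNReal.ofReal ((2 * r) ^ n) := by
        apply (ENNReal.ofReal_lt_ofReal_iff (pow_pos (by linarith) n)).2
        calc 2 * (volume E).toReal < 2 * r := by linarith
          _ ≤ (2 * r) ^ n := le_self_pow₀ (by linarith) (by omega)
  obtain ⟨r₀, hr₀, hr₀pos⟩ :=
    ((hx.eventually (lt_mem_nhds (show (2⁻¹ : ℝ≥0∞) < 1 by simp))).and
      self_mem_nhdsWithin).exists
  replace hr₀pos : 0 < r₀ := hr₀pos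
  have hr₀' : volume (closedBall x r₀) ≤ 2 * volume (E ∩ closedBall x r₀) := by
    have h3 := ENNReal.mul_le_of_le_div hr₀.le
    calc volume (closedBall x r₀) = 2 * (2⁻¹ * volume (closedBall x r₀)) := by
          rw [← mul_assoc, ENNReal.mul_inv_cancel (by simp) (by simp), one_mul]
      _ ≤ _ := by gcongr
  have ex : ∃ k : ℕ, 2 * volume (E ∩ closedBall x (5 * (5 ^ k * r₀))) ≤
      volume (closedBall x (5 * (5 ^ k * r₀))) := by
    obtain ⟨k, hk⟩ := pow_unbounded_of_one_lt (((volume E).toReal + 1) / r₀)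
      (show (1 : ℝ) < 5 by norm_num)
    rw [div_lt_iff₀ hr₀pos] at hk
    refine ⟨k, (large _ ?_).le⟩
    have : 0 < 5 ^ k * r₀ := by positivity
    linarith
  classical
  have h4 : volume (closedBall x (5 ^ Nat.find ex * r₀)) ≤
      2 * volume (E ∩ closedBall x (5 ^ Nat.find ex * r₀)) := by
    rcases h : Nat.find ex with _ | m
    · simpa using hr₀'
    · have := Nat.find_min ex (m := m) (by omega)
      rw [pow_succ', mul_assoc]
      exact (not_le.1 this).le
  refine ⟨5 ^ Nat.find ex * r₀, by positivity, ?_, h4, Nat.find_spec ex⟩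
  by_contra! h
  exact absurd h4 (not_le.2 (large _ h))

/-- A set `E` of finite measure is covered, up to a null set, by countably many balls (for the sup
norm, i.e. cubes) of total measure at most `2 * 5 ^ n * |E|`, each of which is at least half
outside `E`. This replaces the stopping-time selection of dyadic cubes by the Vitali covering
lemma. -/
theorem exists_covering_half_density {n : ℕ} (hn : 1 ≤ n) {E : Set (Fin n → ℝ)}
    (hEm : NullMeasurableSet E volume) (hE : volume E ≠ ∞) :
    ∃ (t : Set (Fin n → ℝ)) (r : (Fin n → ℝ) → ℝ), t.Countable ∧ (∀ x ∈ t, 0 < r x) ∧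
      (∀ x ∈ t, 2 * volume (E ∩ closedBall x (r x)) ≤ volume (closedBall x (r x))) ∧
      ∑' x : t, volume (closedBall (x : Fin n → ℝ) (r x)) ≤ 2 * 5 ^ n * volume E ∧
      volume (E \ ⋃ x ∈ t, closedBall x (r x)) = 0 := by
  have key := Besicovitch.ae_tendsto_measure_inter_div volume E
  rw [ae_restrict_iff'₀ hEm] at key
  set D : Set (Fin n → ℝ) := {x | Tendsto (fun r =>
    volume (E ∩ closedBall x r) / volume (closedBall x r)) (𝓝[>] 0) (𝓝 1)} with hD
  have hrad : ∀ x : Fin n → ℝ, ∃ r : ℝ, x ∈ D → 0 < r ∧ r ≤ (volume E).toReal + 1 ∧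
      volume (closedBall x r) ≤ 2 * volume (E ∩ closedBall x r) ∧
      2 * volume (E ∩ closedBall x (5 * r)) ≤ volume (closedBall x (5 * r)) := by
    intro x
    by_cases hx : x ∈ D
    · obtain ⟨r, hr⟩ := exists_radius_half_density hn hE hx
      exact ⟨r, fun _ => hr⟩
    · exact ⟨0, fun h => absurd h hx⟩
  choose r hr using hrad
  obtain ⟨t, htD, hdisj, hcov⟩ := Vitali.exists_disjoint_subfamily_covering_enlargement_closedBall
    D id r ((volume E).toReal + 1) (fun x hx => (hr x hx).2.1) 5 (by norm_num)
  simp only [id] at hdisj hcov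
  have htc : t.Countable := hdisj.countable_of_nonempty_interior fun x hx =>
    ⟨x, ball_subset_interior_closedBall (mem_ball_self (hr x (htD hx)).1)⟩
  refine ⟨t, fun x => 5 * r x, htc, fun x hx => by have := (hr x (htD hx)).1; positivity,
    fun x hx => (hr x (htD hx)).2.2.2, ?_, ?_⟩
  · have h5 : ∀ x ∈ t, volume (closedBall x (5 * r x)) ≤
        2 * 5 ^ n * volume.restrict E (closedBall x (r x)) := by
      intro x hx
      obtain ⟨hpos, -, h, -⟩ := hr x (htD hx)
      rw [Measure.restrict_apply measurableSet_closedBall, Set.inter_comm]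
      rw [Real.volume_pi_closedBall _ hpos.le, Fintype.card_fin] at h
      rw [Real.volume_pi_closedBall _ (by positivity), Fintype.card_fin]
      calc ENNReal.ofReal ((2 * (5 * r x)) ^ n)
          = 5 ^ n * ENNReal.ofReal ((2 * r x) ^ n) := by
            rw [show (2 * (5 * r x)) ^ n = 5 ^ n * (2 * r x) ^ n by rw [← mul_pow]; ring,
              ENNReal.ofReal_mul (by positivity), ENNReal.ofReal_pow (by norm_num)]
            simp
        _ ≤ 5 ^ n * (2 * volume (E ∩ closedBall x (r x))) := by gcongr
        _ = _ := by ring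
    calc ∑' x : t, volume (closedBall (x : Fin n → ℝ) (5 * r x))
        ≤ ∑' x : t, 2 * 5 ^ n * volume.restrict E (closedBall (x : Fin n → ℝ) (r x)) :=
          ENNReal.tsum_le_tsum fun x => h5 x x.2
      _ = 2 * 5 ^ n * volume.restrict E (⋃ x ∈ t, closedBall x (r x)) := by
          rw [ENNReal.tsum_mul_left,
            measure_biUnion htc hdisj fun _ _ => measurableSet_closedBall]
      _ ≤ 2 * 5 ^ n * volume E := by
          refine mul_le_mul' le_rfl ?_
          exact (measure_mono (Set.subset_univ _)).trans_eq (Measure.restrict_apply_univ E)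
  · refine measure_mono_null ?_ key
    rintro x ⟨hxE, hx⟩ h
    obtain ⟨y, hy, hxy⟩ := hcov x (h hxE)
    exact hx (Set.mem_biUnion hy (hxy (mem_closedBall_self (hr x (h hxE)).1.le)))

/-! ### Distributional decay of BMO functions -/

theorem cube_eq_closedBall {n : ℕ} (x : Fin n → ℝ) {r : ℝ} (hr : 0 ≤ r) :
    cube (fun i => x i - r) (2 * r) = closedBall x r := by
  ext y
  rw [mem_closedBall, dist_pi_le_iff hr]
  refine forall_congr' fun i => ?_
  rw [Real.dist_eq, abs_le]
  constructor <;> rintro ⟨h1, h2⟩ <;> constructor <;> linarith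

theorem lintegral_closedBall_sub_average_le {n : ℕ} {𝕜 : Type*} [RCLike 𝕜] {f : (Fin n → ℝ) → 𝕜}
    {b : ℝ≥0∞} (hb : bmoNorm f ≤ b) (x : Fin n → ℝ) {r : ℝ} (hr : 0 < r) :
    ∫⁻ y in closedBall x r, ‖f y - ⨍ z in closedBall x r, f z ∂volume‖ₑ ≤
      b * volume (closedBall x r) := by
  have h : ⨍⁻ y in cube (fun i => x i - r) (2 * r),
      ‖f y - ⨍ z in cube (fun i => x i - r) (2 * r), f z ∂volume‖ₑ ∂volume ≤ b := by
    rw [bmoNorm] at hb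
    simp only [iSup_le_iff] at hb
    exact hb _ _ (by positivity)
  rw [cube_eq_closedBall x hr.le, setLAverage_eq] at h
  rwa [ENNReal.div_le_iff (measure_closedBall_pos _ _ hr).ne' measure_closedBall_lt_top.ne] at h

/-- Chebyshev's inequality for the oscillation of a BMO function on a ball of the sup norm. -/
theorem measure_closedBall_sub_average_le {n : ℕ} {𝕜 : Type*} [RCLike 𝕜] {f : (Fin n → ℝ) → 𝕜}
    (hf : AEStronglyMeasurable f volume) {b : ℝ≥0} (hb0 : 0 < b) (hb : bmoNorm f ≤ b)
    (x : Fin n → ℝ) {r : ℝ} (hr : 0 < r) (M : ℝ≥0) :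
    M * volume (closedBall x r ∩
      {y | M * b ≤ ‖f y - ⨍ z in closedBall x r, f z ∂volume‖₊}) ≤ volume (closedBall x r) := by
  have h1 := lintegral_closedBall_sub_average_le hb x hr
  have hm : AEMeasurable (fun y => ‖f y - ⨍ z in closedBall x r, f z ∂volume‖ₑ)
      (volume.restrict (closedBall x r)) :=
    (hf.restrict.sub aestronglyMeasurable_const).enorm
  have h2 := (mul_meas_ge_le_lintegral₀ hm ((M * b : ℝ≥0) : ℝ≥0∞)).trans h1
  rw [Measure.restrict_apply' measurableSet_closedBall, Set.inter_comm, ENNReal.coe_mul,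
    mul_comm (M : ℝ≥0∞), mul_assoc,
    ENNReal.mul_le_mul_iff_right (by exact_mod_cast hb0.ne') ENNReal.coe_ne_top] at h2
  convert h2 using 6
  rw [← ENNReal.coe_mul, mul_comm b, enorm_eq_nnnorm, ENNReal.coe_le_coe]

/-- The distribution function of a BMO function halves whenever the level is raised by a fixed
multiple of the BMO seminorm. Each cube of a covering of `{|f| > α}` is at least half outside this
set, so the mean of `f` there exceeds `α` by at most `3 b`, and Chebyshev's inequality applies. -/
theorem two_mul_distribFun_add_le {n : ℕ} (hn : 1 ≤ n) {𝕜 : Type*} [RCLike 𝕜]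
    {f : (Fin n → ℝ) → 𝕜} (hf : AEStronglyMeasurable f volume) {b : ℝ≥0} (hb0 : 0 < b)
    (hb : bmoNorm f ≤ b) (α : ℝ≥0) :
    2 * distribFun f (α + (3 + 4 * 5 ^ n) * b) ≤ distribFun f α := by
  set E : Set (Fin n → ℝ) := {x | α < ‖f x‖₊} with hEdef
  set F : Set (Fin n → ℝ) := {x | α + (3 + 4 * 5 ^ n) * b < ‖f x‖₊} with hFdef
  change 2 * volume F ≤ volume E
  by_cases hE : volume E = ∞
  · rw [hE]; exact le_top
  have hEm : NullMeasurableSet E volume :=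
    nullMeasurableSet_lt aemeasurable_const hf.nnnorm.aemeasurable
  have hFE : F ⊆ E := fun x hx => lt_of_le_of_lt (le_self_add : α ≤ α + _) hx
  obtain ⟨t, r, htc, hrpos, hhalf, hsum, hnull⟩ := exists_covering_half_density hn hEm hE
  have hball : ∀ x ∈ t, 4 * 5 ^ n * volume (F ∩ closedBall x (r x)) ≤
      volume (closedBall x (r x)) := by
    intro x hx
    set Q := closedBall x (r x) with hQ
    set c := ⨍ z in Q, f z ∂volume with hc
    have hQ0 : volume Q ≠ 0 := (measure_closedBall_pos _ _ (hrpos x hx)).ne'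
    have hQt : volume Q ≠ ∞ := measure_closedBall_lt_top.ne
    have cheb := measure_closedBall_sub_average_le hf hb0 hb x (hrpos x hx)
    obtain ⟨y, ⟨hyQ, hyE⟩, hy⟩ : ∃ y ∈ Q \ E, ‖f y - c‖₊ < 3 * b := by
      by_contra! hcon
      have h3 : 3 * volume (Q \ E) ≤ volume Q := by
        refine le_trans ?_ (cheb 3)
        push_cast
        gcongr
        exact fun y hy => ⟨hy.1, hcon y hy⟩
      have h2 : volume Q ≤ volume (E ∩ Q) + volume (Q \ E) := by
        refine le_trans (measure_mono ?_) (measure_union_le _ _)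
        intro z hz
        by_cases hzE : z ∈ E
        · exact Or.inl ⟨hzE, hz⟩
        · exact Or.inr ⟨hz, hzE⟩
      have h1 := hhalf x hx
      have h4 : volume (E ∩ Q) ≠ ∞ := measure_ne_top_of_subset Set.inter_subset_right hQt
      have h5 : volume (Q \ E) ≠ ∞ := measure_ne_top_of_subset Set.sdiff_subset hQt
      rw [← hQ] at h1
      lift volume Q to ℝ≥0 using hQt with v
      lift volume (E ∩ Q) to ℝ≥0 using h4 with v₁
      lift volume (Q \ E) to ℝ≥0 using h5 with v₂
      norm_cast at *
      have : v ≤ 0 := by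
        rw [← NNReal.coe_le_coe] at *
        push_cast at *
        linarith
      exact hQ0 (nonpos_iff_eq_zero.1 this)
    have hcb : ‖c‖₊ ≤ α + 3 * b := by
      have h1 : ‖f y‖₊ ≤ α := not_lt.1 hyE
      rw [← NNReal.coe_le_coe] at *
      rw [← NNReal.coe_lt_coe] at hy
      push_cast at *
      have := norm_sub_norm_le c (f y)
      rw [norm_sub_rev] at this
      linarith
    refine le_trans ?_ (cheb (4 * 5 ^ n))
    push_cast
    refine mul_le_mul' le_rfl (measure_mono ?_)
    rintro z ⟨hzF, hzQ⟩
    refine ⟨hzQ, ?_⟩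
    simp only [hFdef, Set.mem_ofPred_eq] at hzF ⊢
    rw [← NNReal.coe_le_coe] at *
    rw [← NNReal.coe_lt_coe] at hzF
    push_cast at *
    have := norm_sub_norm_le (f z) c
    linarith
  have hcover : volume F ≤ ∑' x : t, volume (F ∩ closedBall (x : Fin n → ℝ) (r x)) := by
    have h1 : F ⊆ (E \ ⋃ x ∈ t, closedBall x (r x)) ∪ ⋃ x ∈ t, F ∩ closedBall x (r x) := by
      intro y hy
      by_cases h : y ∈ ⋃ x ∈ t, closedBall x (r x)
      · right
        obtain ⟨x, hx, hyx⟩ := Set.mem_iUnion₂.1 h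
        exact Set.mem_biUnion hx ⟨hy, hyx⟩
      · exact Or.inl ⟨hFE hy, h⟩
    calc volume F ≤ _ := (measure_mono h1).trans (measure_union_le _ _)
      _ ≤ _ := by rw [hnull, zero_add]; exact measure_biUnion_le _ htc _
  have hfin : 4 * 5 ^ n * volume F ≤ 2 * 5 ^ n * volume E := by
    calc 4 * 5 ^ n * volume F
        ≤ ∑' x : t, 4 * 5 ^ n * volume (F ∩ closedBall (x : Fin n → ℝ) (r x)) := by
          rw [ENNReal.tsum_mul_left]; gcongr
      _ ≤ _ := ENNReal.tsum_le_tsum fun x => hball x x.2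
      _ ≤ _ := hsum
  rw [show (4 : ℝ≥0∞) * 5 ^ n * volume F = 2 * 5 ^ n * (2 * volume F) by ring,
    ENNReal.mul_le_mul_iff_right (by simp) (ENNReal.mul_ne_top (by simp) (by simp))] at hfin
  exact hfin

theorem two_pow_mul_distribFun_add_le {n : ℕ} (hn : 1 ≤ n) {𝕜 : Type*} [RCLike 𝕜]
    {f : (Fin n → ℝ) → 𝕜} (hf : AEStronglyMeasurable f volume) {b : ℝ≥0} (hb0 : 0 < b)
    (hb : bmoNorm f ≤ b) (α : ℝ≥0) (j : ℕ) :
    2 ^ j * distribFun f (α + j * ((3 + 4 * 5 ^ n) * b)) ≤ distribFun f α := by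
  induction j with
  | zero => simp
  | succ j ih =>
    refine le_trans ?_ ih
    rw [pow_succ, mul_assoc]
    gcongr
    have h := two_mul_distribFun_add_le hn hf hb0 hb (α + j * ((3 + 4 * 5 ^ n) * b))
    rwa [add_assoc, ← add_one_mul, ← Nat.cast_succ] at h

/-! ### Bounds for the decreasing rearrangement -/

theorem distribFun_le_of_decrRearr_lt {n : ℕ} {𝕜 : Type*} [RCLike 𝕜] {f : (Fin n → ℝ) → 𝕜} {t : ℝ}
    {α : ℝ≥0} (h : decrRearr f t < α) : distribFun f α ≤ ENNReal.ofReal t := by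
  simp only [decrRearr, iInf_lt_iff] at h
  obtain ⟨β, hβ, hlt⟩ := h
  refine le_trans (measure_mono fun x hx => ?_) hβ
  exact lt_trans (by exact_mod_cast hlt) hx

theorem decrRearr_le_of_distribFun_le {n : ℕ} {𝕜 : Type*} [RCLike 𝕜] {f : (Fin n → ℝ) → 𝕜} {t : ℝ}
    {α : ℝ≥0} (h : distribFun f α ≤ ENNReal.ofReal t) : decrRearr f t ≤ α :=
  iInf₂_le α h

theorem decrRearr_antitone {n : ℕ} {𝕜 : Type*} [RCLike 𝕜] (f : (Fin n → ℝ) → 𝕜) :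
    Antitone (decrRearr f) := fun _ _ hst =>
  le_iInf₂ fun α hα => iInf₂_le α (hα.trans (ENNReal.ofReal_le_ofReal hst))

theorem decrRearr_le_of_lorentzNorm_top_le {n : ℕ} {𝕜 : Type*} [RCLike 𝕜] {f : (Fin n → ℝ) → 𝕜}
    {q : ℝ} {a : ℝ≥0} (ha : lorentzNorm q ∞ f ≤ a) {t : ℝ} (ht : 0 < t) :
    decrRearr f t ≤ ENNReal.ofReal (a * t ^ (-(1 / q))) := by
  have h : ENNReal.ofReal t ^ (1 / q) * decrRearr f t ≤ a := by
    refine le_trans ?_ ha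
    rw [lorentzNorm, if_pos rfl]
    exact le_iSup₂_of_le t ht le_rfl
  rw [ENNReal.ofReal_rpow_of_pos ht] at h
  have hpos : 0 < t ^ (1 / q) := Real.rpow_pos_of_pos ht _
  rw [Real.rpow_neg ht.le, ← div_eq_mul_inv, ENNReal.ofReal_div_of_pos hpos,
    ENNReal.ofReal_coe_nnreal, ENNReal.le_div_iff_mul_le (Or.inl (ENNReal.ofReal_pos.2 hpos).ne')
      (by simp), mul_comm]
  exact h

/-- Below the point `T` at which `f^*` has come down to the size of the BMO seminorm, `f^*` grows at
most logarithmically in `T / t`, hence more slowly than any power `(T / t) ^ ε`. -/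
theorem decrRearr_le_rpow {n : ℕ} (hn : 1 ≤ n) {𝕜 : Type*} [RCLike 𝕜]
    {f : (Fin n → ℝ) → 𝕜} (hf : AEStronglyMeasurable f volume) {b : ℝ≥0} (hb0 : 0 < b)
    (hb : bmoNorm f ≤ b) {T : ℝ} (hT : decrRearr f T ≤ b) {ε : ℝ} (hε : 0 < ε)
    {t : ℝ} (ht : 0 < t) (htT : t ≤ T) :
    decrRearr f t ≤ ENNReal.ofReal
      ((2 + (3 + 4 * 5 ^ n) + (3 + 4 * 5 ^ n) / (ε * Real.log 2)) * b * (T / t) ^ ε) := by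
  have hTpos : 0 < T := ht.trans_le htT
  set K : ℝ≥0 := 3 + 4 * 5 ^ n with hK
  have hd : distribFun f (2 * b) ≤ ENNReal.ofReal T :=
    distribFun_le_of_decrRearr_lt (hT.trans_lt (by
      exact_mod_cast (lt_two_mul_self hb0)))
  have step : ∀ j : ℕ, decrRearr f (T * (1 / 2) ^ j) ≤ ((2 * b + j * (K * b) : ℝ≥0) : ℝ≥0∞) := by
    intro j
    refine decrRearr_le_of_distribFun_le ?_
    have h := (two_pow_mul_distribFun_add_le hn hf hb0 hb (2 * b) j).trans hd
    rw [one_div, inv_pow, ← div_eq_mul_inv, ENNReal.ofReal_div_of_pos (by positivity),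
      ENNReal.le_div_iff_mul_le (by simp) (by simp), ENNReal.ofReal_pow (by norm_num), mul_comm]
    simpa using h
  obtain ⟨j, hj1, hj2⟩ := exists_nat_pow_near_of_lt_one (div_pos ht hTpos)
    ((div_le_one hTpos).2 htT) (show (0 : ℝ) < 1 / 2 by norm_num) (by norm_num)
  rw [lt_div_iff₀ hTpos, mul_comm] at hj1
  refine (decrRearr_antitone f hj1.le).trans ((step (j + 1)).trans ?_)
  rw [← ENNReal.ofReal_coe_nnreal]
  apply ENNReal.ofReal_le_ofReal
  have hlog : 0 < Real.log 2 := Real.log_pos (by norm_num)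
  have hpow : 1 + j * (ε * Real.log 2) ≤ (T / t) ^ ε := by
    have h1 : (2 : ℝ) ^ j ≤ T / t := by
      rw [← inv_div, le_inv_comm₀ (by positivity) (by positivity)]
      simpa using hj2
    calc 1 + j * (ε * Real.log 2) ≤ Real.exp (j * (ε * Real.log 2)) := by
          rw [add_comm]; exact Real.add_one_le_exp _
      _ = ((2 : ℝ) ^ j) ^ ε := by
          rw [← Real.rpow_natCast, ← Real.rpow_mul (by norm_num), Real.rpow_def_of_pos (by norm_num)]
          congr 1; ring
      _ ≤ (T / t) ^ ε := Real.rpow_le_rpow (by positivity) h1 hε.le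
  have hKr : (3 + 4 * 5 ^ n : ℝ) = K := by rw [hK]; push_cast; rfl
  rw [hKr]
  have hK0 : (0 : ℝ) ≤ K := K.2
  have hb0' : (0 : ℝ) ≤ b := b.2
  have hε' : 0 < ε * Real.log 2 := by positivity
  calc (((2 * b + (j + 1 : ℕ) * (K * b) : ℝ≥0)) : ℝ) = (2 + K + j * K) * b := by push_cast; ring
    _ ≤ ((2 + K + K / (ε * Real.log 2)) * (1 + j * (ε * Real.log 2))) * b := by
        refine mul_le_mul_of_nonneg_right ?_ hb0'
        have h1 : K / (ε * Real.log 2) * (j * (ε * Real.log 2)) = j * K := by field_simp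
        have h2 : 0 ≤ (K : ℝ) / (ε * Real.log 2) := by positivity
        have h3 : 0 ≤ (2 + K : ℝ) * (j * (ε * Real.log 2)) := by positivity
        nlinarith
    _ = (2 + K + K / (ε * Real.log 2)) * b * (1 + j * (ε * Real.log 2)) := by ring
    _ ≤ _ := by gcongr

/-! ### Integration of the rearrangement -/

theorem setLIntegral_Ioc_rpow {s T : ℝ} (hs : -1 < s) (hT : 0 ≤ T) :
    ∫⁻ t in Set.Ioc 0 T, ENNReal.ofReal (t ^ s) = ENNReal.ofReal (T ^ (s + 1) / (s + 1)) := by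
  have hi := (intervalIntegral.intervalIntegrable_rpow' (a := 0) (b := T) hs).1
  rw [← ofReal_integral_eq_lintegral_ofReal hi, ← intervalIntegral.integral_of_le hT,
    integral_rpow (Or.inl hs), Real.zero_rpow (by linarith), sub_zero]
  filter_upwards [ae_restrict_mem measurableSet_Ioc] with t ht
  exact Real.rpow_nonneg ht.1.le _

theorem setLIntegral_Ioi_rpow {s T : ℝ} (hs : s < -1) (hT : 0 < T) :
    ∫⁻ t in Set.Ioi T, ENNReal.ofReal (t ^ s) = ENNReal.ofReal (-T ^ (s + 1) / (s + 1)) := by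
  rw [← ofReal_integral_eq_lintegral_ofReal (integrableOn_Ioi_rpow_of_lt hs hT),
    integral_Ioi_rpow_of_lt hs hT]
  filter_upwards [ae_restrict_mem measurableSet_Ioi] with t ht
  exact Real.rpow_nonneg (hT.trans ht).le _

theorem ofReal_rpow_mul_div_le {p c s t : ℝ} {y : ℝ≥0∞} (ht : 0 < t) (hc : 0 ≤ c)
    (h : y ≤ ENNReal.ofReal (c * t ^ s)) :
    ENNReal.ofReal t ^ (1 / p) * y / ENNReal.ofReal t ≤
      ENNReal.ofReal c * ENNReal.ofReal (t ^ (1 / p + s - 1)) := by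
  calc ENNReal.ofReal t ^ (1 / p) * y / ENNReal.ofReal t
      ≤ ENNReal.ofReal (t ^ (1 / p)) * ENNReal.ofReal (c * t ^ s) / ENNReal.ofReal t := by
        rw [ENNReal.ofReal_rpow_of_pos ht]; gcongr
    _ = _ := by
        rw [← ENNReal.ofReal_mul (by positivity), ← ENNReal.ofReal_div_of_pos ht,
          ← ENNReal.ofReal_mul hc, Real.rpow_sub ht, Real.rpow_add ht, Real.rpow_one]
        congr 1; ring

/-- The interpolation constant, obtained with the exponent `ε = 1 / (2 p)`. -/
noncomputable def interpConst (n : ℕ) (p q : ℝ) : ℝ :=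
  2 * p * (2 + (3 + 4 * 5 ^ n) + (3 + 4 * 5 ^ n) / (1 / (2 * p) * Real.log 2)) +
    1 / (1 / q - 1 / p)

/-- The interpolation inequality with positive upper bounds in place of the two norms. -/
theorem lorentzNorm_one_le_of_le {n : ℕ} (hn : 1 ≤ n) {p q : ℝ} (hq : 1 < q) (hqp : q < p)
    {𝕜 : Type*} [RCLike 𝕜] {f : (Fin n → ℝ) → 𝕜} (hf : AEStronglyMeasurable f volume)
    {a b : ℝ≥0} (ha0 : 0 < a) (hb0 : 0 < b) (ha : lorentzNorm q ∞ f ≤ a) (hb : bmoNorm f ≤ b) :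
    lorentzNorm p 1 f ≤
      ENNReal.ofReal (interpConst n p q) * (a : ℝ≥0∞) ^ (q / p) * (b : ℝ≥0∞) ^ (1 - q / p) := by
  have hq0 : 0 < q := by linarith
  have hp0 : 0 < p := by linarith
  have haR : (0 : ℝ) < a := ha0
  have hbR : (0 : ℝ) < b := hb0
  have hpq : 1 / p < 1 / q := one_div_lt_one_div_of_lt hq0 hqp
  -- The two bounds `a t^{-1/q}` and `b` for `f^*(t)` balance at `t = T`.
  set T : ℝ := (a / b : ℝ) ^ q with hTdef
  have hT : 0 < T := by positivity
  have hTb : decrRearr f T ≤ b := by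
    refine (decrRearr_le_of_lorentzNorm_top_le ha hT).trans_eq ?_
    rw [hTdef, ← Real.rpow_mul (by positivity), show q * -(1 / q) = -1 by field_simp,
      Real.rpow_neg_one, inv_div, mul_div_cancel₀ _ haR.ne', ENNReal.ofReal_coe_nnreal]
  set c : ℝ := 2 + (3 + 4 * 5 ^ n) + (3 + 4 * 5 ^ n) / (1 / (2 * p) * Real.log 2) with hc
  have hlog : 0 < Real.log 2 := Real.log_pos (by norm_num)
  have hc0 : 0 ≤ c := by positivity
  set ε : ℝ := 1 / (2 * p) with hε
  have hε0 : 0 < ε := by positivity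
  have hsplit : lorentzNorm p 1 f =
      (∫⁻ t in Set.Ioc 0 T, ENNReal.ofReal t ^ (1 / p) * decrRearr f t / ENNReal.ofReal t) +
        ∫⁻ t in Set.Ioi T, ENNReal.ofReal t ^ (1 / p) * decrRearr f t / ENNReal.ofReal t := by
    rw [lorentzNorm, if_neg ENNReal.one_ne_top, ← lintegral_union measurableSet_Ioi
      (Set.Ioc_disjoint_Ioi le_rfl), Set.Ioc_union_Ioi_eq_Ioi hT.le]
    simp
  have hε2 : 1 / p - ε = ε := by rw [hε]; field_simp; ring
  have hlow : ∫⁻ t in Set.Ioc 0 T, ENNReal.ofReal t ^ (1 / p) * decrRearr f t / ENNReal.ofReal t ≤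
      ENNReal.ofReal (2 * p * c * ((a : ℝ) ^ (q / p) * (b : ℝ) ^ (1 - q / p))) := by
    calc _ ≤ ∫⁻ t in Set.Ioc 0 T, ENNReal.ofReal (c * b * T ^ ε) *
          ENNReal.ofReal (t ^ (ε - 1)) := by
          refine setLIntegral_mono' measurableSet_Ioc fun t ht => ?_
          have h := decrRearr_le_rpow hn hf hb0 hb hTb hε0 ht.1 ht.2
          have h' := ofReal_rpow_mul_div_le (p := p) (c := c * b * T ^ ε) (s := -ε)
            (y := decrRearr f t) ht.1 (by positivity) (h.trans_eq (by
              rw [Real.div_rpow hT.le ht.1.le, Real.rpow_neg ht.1.le]; congr 1; ring))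
          rwa [← sub_eq_add_neg, hε2] at h'
      _ = ENNReal.ofReal (c * b * T ^ ε * (T ^ ε / ε)) := by
          rw [lintegral_const_mul' _ _ ENNReal.ofReal_ne_top,
            setLIntegral_Ioc_rpow (by linarith) hT.le, ← ENNReal.ofReal_mul (by positivity),
            sub_add_cancel]
      _ = _ := by
          congr 1
          have h1 : T ^ ε * T ^ ε = (a : ℝ) ^ (q / p) * (b : ℝ) ^ (-(q / p)) := by
            rw [← Real.rpow_add hT, hTdef, ← Real.rpow_mul (by positivity),
              show q * (ε + ε) = q / p by rw [hε]; field_simp; norm_num,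
              Real.div_rpow haR.le hbR.le, Real.rpow_neg hbR.le]
            rfl
          rw [sub_eq_add_neg, Real.rpow_add hbR, Real.rpow_one]
          calc c * b * T ^ ε * (T ^ ε / ε) = c * b * (T ^ ε * T ^ ε) / ε := by ring
            _ = _ := by rw [h1, hε]; field_simp
  have hhigh : ∫⁻ t in Set.Ioi T, ENNReal.ofReal t ^ (1 / p) * decrRearr f t / ENNReal.ofReal t ≤
      ENNReal.ofReal (1 / (1 / q - 1 / p) * ((a : ℝ) ^ (q / p) * (b : ℝ) ^ (1 - q / p))) := by
    calc _ ≤ ∫⁻ t in Set.Ioi T, ENNReal.ofReal a *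
          ENNReal.ofReal (t ^ (1 / p + -(1 / q) - 1)) := by
          refine setLIntegral_mono' measurableSet_Ioi fun t ht => ?_
          have ht0 : 0 < t := hT.trans ht
          exact ofReal_rpow_mul_div_le ht0 haR.le (decrRearr_le_of_lorentzNorm_top_le ha ht0)
      _ = ENNReal.ofReal (a * (T ^ (1 / p - 1 / q) / (1 / q - 1 / p))) := by
          rw [lintegral_const_mul' _ _ ENNReal.ofReal_ne_top,
            setLIntegral_Ioi_rpow (by linarith) hT, ← ENNReal.ofReal_mul haR.le,
            sub_add_cancel, ← sub_eq_add_neg, ← neg_sub (1 / q) (1 / p), neg_div_neg_eq]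
      _ = _ := by
          congr 1
          have h1 : T ^ (1 / p - 1 / q) = (a : ℝ) ^ (q / p) / a * (b : ℝ) ^ (1 - q / p) := by
            rw [hTdef, ← Real.rpow_mul (by positivity),
              show q * (1 / p - 1 / q) = q / p - 1 by field_simp,
              Real.div_rpow haR.le hbR.le, Real.rpow_sub haR, Real.rpow_one,
              ← neg_sub (q / p) 1, Real.rpow_neg hbR.le]
            rfl
          rw [h1]
          field_simp
  rw [hsplit]
  refine (add_le_add hlow hhigh).trans_eq ?_
  have hd : 0 < 1 / q - 1 / p := by linarith
  have hC : interpConst n p q = 2 * p * c + 1 / (1 / q - 1 / p) := rfl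
  rw [← ENNReal.ofReal_add (by positivity) (by positivity), ← add_mul, ← hC,
    ENNReal.ofReal_mul (by rw [hC]; positivity), ENNReal.ofReal_mul (by positivity),
    ← ENNReal.ofReal_rpow_of_pos haR, ← ENNReal.ofReal_rpow_of_pos hbR,
    ENNReal.ofReal_coe_nnreal, ENNReal.ofReal_coe_nnreal, mul_assoc]

theorem corollary10p3 (n : ℕ) (hn : 1 ≤ n) (p q : ℝ) (hq : 1 < q) (hqp : q < p) :
    ∃ C : ℝ≥0, ∀ (𝕜 : Type*) [RCLike 𝕜] (u : (Fin n → ℝ) → 𝕜),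
      MemLorentz q ∞ u → MemBMO u →
        MemLorentz p 1 u ∧
        lorentzNorm p 1 u ≤ C * lorentzNorm q ∞ u ^ (q / p) * bmoNorm u ^ (1 - q / p) := by
  refine ⟨(interpConst n p q).toNNReal, fun 𝕜 _ u hL hB => ?_⟩
  have hθ0 : 0 ≤ q / p := div_nonneg (by linarith) (by linarith)
  have hθ1 : 0 ≤ 1 - q / p := sub_nonneg.2 ((div_le_one (by linarith)).2 hqp.le)
  have hA := hL.2.ne
  have hBt := hB.2.ne
  -- Either norm may vanish, so both are perturbed by `δ > 0` and `δ` is sent to `0`.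
  have main : lorentzNorm p 1 u ≤ ((interpConst n p q).toNNReal : ℝ≥0∞) *
      lorentzNorm q ∞ u ^ (q / p) * bmoNorm u ^ (1 - q / p) := by
    set A := lorentzNorm q ∞ u
    set B := bmoNorm u
    have htend : Tendsto (fun δ : ℝ≥0 => ((interpConst n p q).toNNReal : ℝ≥0∞) *
        (A + δ) ^ (q / p) * (B + δ) ^ (1 - q / p)) (𝓝[>] 0)
        (𝓝 (((interpConst n p q).toNNReal : ℝ≥0∞) * A ^ (q / p) * B ^ (1 - q / p))) := by
      have hadd : ∀ X : ℝ≥0∞, Tendsto (fun δ : ℝ≥0 => X + δ) (𝓝[>] 0) (𝓝 X) := fun X => by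
        have h : Continuous fun δ : ℝ≥0 => X + (δ : ℝ≥0∞) := by fun_prop
        simpa using h.continuousWithinAt.tendsto (x := 0) (s := Set.Ioi 0)
      have hA' : A ^ (q / p) ≠ ∞ := ENNReal.rpow_ne_top_of_nonneg hθ0 hA
      have hB' : B ^ (1 - q / p) ≠ ∞ := ENNReal.rpow_ne_top_of_nonneg hθ1 hBt
      exact ENNReal.Tendsto.mul
        (ENNReal.Tendsto.const_mul ((hadd A).ennrpow_const _) (Or.inr ENNReal.coe_ne_top))
        (Or.inr hB') ((hadd B).ennrpow_const _)
        (Or.inr (ENNReal.mul_ne_top ENNReal.coe_ne_top hA'))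
    refine ge_of_tendsto htend ?_
    filter_upwards [self_mem_nhdsWithin] with δ hδ
    replace hδ : 0 < δ := hδ
    have h := lorentzNorm_one_le_of_le hn hq hqp hL.1 (a := A.toNNReal + δ) (b := B.toNNReal + δ)
      (by positivity) (by positivity)
      (by rw [ENNReal.coe_add, ENNReal.coe_toNNReal hA]; exact le_self_add)
      (by rw [ENNReal.coe_add, ENNReal.coe_toNNReal hBt]; exact le_self_add)
    rwa [ENNReal.coe_add, ENNReal.coe_add, ENNReal.coe_toNNReal hA, ENNReal.coe_toNNReal hBt] at h
  refine ⟨⟨hL.1, main.trans_lt ?_⟩, main⟩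
  exact ENNReal.mul_lt_top (ENNReal.mul_lt_top ENNReal.coe_lt_top
    (ENNReal.rpow_lt_top_of_nonneg hθ0 hA)) (ENNReal.rpow_lt_top_of_nonneg hθ1 hBt)
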